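/- **Setting.** Let $\mathcal C\subseteq\mathbb R^d$ be convex and compact with $2\max_{y\in\mathcal C}\|y\|_\infty\le 1$, let $\mathcal X$ be a set of contexts, and let $\mathcal E$ be a finite collection of events, an event being an arbitrary map that sends a finite transcript $\pi$ of triples in $\mathcal X\times\mathcal C\times\mathcal C$, a context $x$ and a prediction $p\in\mathcal C$ to a number $E(\pi,x,p)\in[0,1]$. In each round $t=1,\dots,T$ an adversary chooses, possibly at random and depending on the past, a context $x_t\in\mathcal X$ and an outcome $y_t\in\mathcal C$; the learner chooses a distribution $\psi_t$ and predicts $p_t\sim\psi_t$, drawn independently of the choice of $y_t$ given the past. Write $\pi_{t-1}=(x_s,p_s,y_s)_{s<t}$ and $E(x_t,p)=E(\pi_{t-1},x_t,p)$. (All random quantities involved are measurable.) **Event weights.** Consider the $n=2d|\mathcal E|$ experts $k=(i,\sigma,E)\in[d]\times\{-1,1\}\times\mathcal E$ with gains $g_{t,(i,\sigma,E)}=\sigma\,E(x_t,p_t)\,(p_{t,i}-y_{t,i})$. Let $q_1,\dots,q_T$ be the distributions over experts played on these gains by Multi-scale Multiplicative Weights with Correction (MsMwC) with horizon $T$: $q_1$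 is uniform, and $$q_{t+1}=\operatorname*{argmin}_{w}\ \sum_k w_k\left(-g_{t,k}+32\,\eta_{t,k}\,g_{t,k}^2\right)+\sum_k\frac1{\eta_{t,k}}\left(w_k\ln\frac{w_k}{q_{t,k}}-w_k+q_{t,k}\right)$$ over all distributions $w$ with $w_k\ge\frac1{nT}$ for every $k$, where $\eta_{t,k}=\min\left\{\frac1{64},\sqrt{\ln(nT)/\sum_{s<t}g_{s,k}^2}\right\}$. **Game.** For each $t$ let $\mathcal C_t\subseteq\mathcal C$ be a finite $\frac1t$-net of $\mathcal C$ in the $\ell_\infty$ norm, and let $$u_t(p,y)=\sum_{i=1}^d\sum_{\sigma\in\{-1,1\}}\sum_{E\in\mathcal E}q_{t,(i,\sigma,E)}\,\sigma\,E(x_t,p)\,(p_i-y_i).$$ Suppose that in every round $t\in[T]$ the learner's $\psi_t$ is a $\frac1t$-approximate minimax strategy of the zero-sum game with payoff $u_t$ in which the learner plays distributions on $\mathcal C_t$ and the adversary plays points of $\mathcal C$: $\psi_t\in\Delta\mathcal C_t$ and $$\max_{y\in\mathcal C}\mathbb E_{p\sim\psi_t}[u_t(p,y)]\le\min_{\psi\in\Delta\mathcal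 C_t}\max_{y\in\mathcal C}\mathbb E_{p\sim\psi}[u_t(p,y)]+\tfrac1t.$$ **Theorem.** There is a universal constant $K>0$ such that, for all $T\ge1$, every coordinate $i\in[d]$ and every event $E\in\mathcal E$, $$\mathbb E\left[\left|\sum_{t=1}^T E(x_t,p_t)\,(p_{t,i}-y_{t,i})\right|\right]\le K\left(\ln(2d|\mathcal E|T)+\sqrt{\ln(2d|\mathcal E|T)\sum_{t=1}^T\mathbb E\left[E(x_t,p_t)^2\right]}\right),$$ where the expectations are over the whole interaction, in which $p_t\sim\psi_t$ for all $t$. -/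

import Mathlib

open MeasureTheory

/-! ### The experts algorithm: multi-scale multiplicative weights with correction -/

section Experts

variable {κ : Type*} [Fintype κ]

/-- The distributions over the experts `κ` all of whose components are at least `δ`. -/
def truncatedSimplex (κ : Type*) [Fintype κ] (δ : ℝ) : Set (κ → ℝ) :=
  {w | w ∈ stdSimplex ℝ κ ∧ ∀ k, δ ≤ w k}

/-- The Bregman divergence `D(w, w')` of the weighted negative entropy
`w ↦ ∑ k, w k * log (w k) / η k`. -/
noncomputable def weightedEntropyDiv (η w w' : κ → ℝ) : ℝ :=
  ∑ k, 1 / η k * (w k * Real.log (w k / w' k) - w k + w' k)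

/-- The learning rate of expert `k` in round `t` (rounds are numbered `0, 1, 2, …`), for horizon `T`
and gains `g`: the minimum of `1 / 64` and `√(log (n * T) / ∑ s < t, (g s k) ^ 2)`, where `n` is the
number of experts (and the second quantity is infinite when the sum vanishes). -/
noncomputable def learningRate (T : ℕ) (g : ℕ → κ → ℝ) (t : ℕ) (k : κ) : ℝ :=
  1 / max 64 (√((∑ s ∈ Finset.range t, g s k ^ 2) / Real.log (Fintype.card κ * T)))

/-- The function minimized in a mirror descent step from `w'`, for the gain vector `g`,
i.e. the loss vector `-g`, with the second-order correction `32 * η k * (g k) ^ 2` of the loss. -/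
noncomputable def stepObjective (η w' g w : κ → ℝ) : ℝ :=
  ∑ k, w k * (-g k + 32 * η k * g k ^ 2) + weightedEntropyDiv η w w'

/-- The distribution over experts that MsMwC with horizon `T` plays in round `t` when the gain
vectors are `g 0, g 1, …`; it depends on `g s` for `s < t` only.  It starts at the uniform
distribution, and each step minimizes `stepObjective` over the distributions with all components
at least `1 / (n * T)`. -/
noncomputable def msMwC (T : ℕ) (g : ℕ → κ → ℝ) : ℕ → κ → ℝ
  | 0 => fun _ => 1 / (Fintype.card κ : ℝ)
  | t + 1 => Classical.epsilon fun w =>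
      w ∈ truncatedSimplex κ (1 / (Fintype.card κ * T)) ∧
        IsMinOn (stepObjective (learningRate T g t) (msMwC T g t) (g t))
          (truncatedSimplex κ (1 / (Fintype.card κ * T))) w

theorem continuous_stepObjective (η w' g : κ → ℝ) : Continuous (stepObjective η w' g) := by
  have key : ∀ c : ℝ, Continuous fun x : ℝ => x * Real.log (x / c) := by
    intro c
    by_cases hc : c = 0
    · subst hc; simpa using continuous_const
    · have h : (fun x : ℝ => x * Real.log (x / c)) =
          fun x : ℝ => c * ((x / c) * Real.log (x / c)) := by
        funext x; field_simp
      rw [h]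
      exact continuous_const.mul
        (Real.continuous_mul_log.comp (continuous_id.div_const c))
  unfold stepObjective weightedEntropyDiv
  refine Continuous.add (by fun_prop) (continuous_finsetSum _ fun k _ => ?_)
  refine continuous_const.mul (((?_ : Continuous _).sub (continuous_apply k)).add continuous_const)
  exact (key (w' k)).comp (continuous_apply k)

/-- The minimizer in the recursion of `msMwC` exists, so `msMwC` really takes it. -/
theorem msMwC_succ_spec [Nonempty κ] {T : ℕ} (hT : 1 ≤ T) (g : ℕ → κ → ℝ) (t : ℕ) :
    msMwC T g (t + 1) ∈ truncatedSimplex κ (1 / (Fintype.card κ * T)) ∧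
      IsMinOn (stepObjective (learningRate T g t) (msMwC T g t) (g t))
        (truncatedSimplex κ (1 / (Fintype.card κ * T))) (msMwC T g (t + 1)) := by
  have hn : (0 : ℝ) < Fintype.card κ := by exact_mod_cast Fintype.card_pos
  have hT' : (1 : ℝ) ≤ T := by exact_mod_cast hT
  have hne : (truncatedSimplex κ (1 / (Fintype.card κ * T))).Nonempty := by
    refine ⟨fun _ => 1 / (Fintype.card κ : ℝ), ⟨fun _ => by positivity, ?_⟩, fun _ => ?_⟩
    · simp [Finset.sum_const, hn.ne']
    · exact one_div_le_one_div_of_le hn (by nlinarith)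
  have hcl : IsClosed {w : κ → ℝ | ∀ k, 1 / ((Fintype.card κ : ℝ) * T) ≤ w k} := by
    simp only [Set.ofPred_forall]
    exact isClosed_iInter fun k => isClosed_le continuous_const (continuous_apply k)
  have hcp : IsCompact (truncatedSimplex κ (1 / (Fintype.card κ * T))) :=
    (isCompact_stdSimplex ℝ κ).inter_right hcl
  obtain ⟨w, hw, hmin⟩ := hcp.exists_isMinOn hne
    (continuous_stepObjective (learningRate T g t) (msMwC T g t) (g t)).continuousOn
  exact Classical.epsilon_spec (p := fun w => w ∈ truncatedSimplex κ (1 / (Fintype.card κ * T)) ∧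
    IsMinOn (stepObjective (learningRate T g t) (msMwC T g t) (g t))
      (truncatedSimplex κ (1 / (Fintype.card κ * T))) w) ⟨w, hw, hmin⟩

end Experts

/-! ### Events, event gains and the per-round game -/

section Prediction

variable {d : ℕ} {X : Type*} {C : Set (Fin d → ℝ)}

/-- An event maps a transcript (a finite list of triples context, prediction, outcome), a context
and a prediction to a number in `[0, 1]`. -/
abbrev Event (X : Type*) (C : Set (Fin d → ℝ)) : Type _ :=
  List (X × C × C) → X → C → Set.Icc (0 : ℝ) 1

/-- The experts: triples of a coordinate, a sign `±1` and an event of the collection. -/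
abbrev EventExpert (𝓔 : Finset (Event X C)) : Type _ := Fin d × ℤˣ × 𝓔

/-- The transcript of the rounds before round `t`, for the sequence `z` of triples
(context, prediction, outcome). -/
def transcript (z : ℕ → X × C × C) (t : ℕ) : List (X × C × C) :=
  (List.range t).map z

/-- The value of the event `E` in round `t` of `z`, if the prediction of that round were `c`. -/
def eventAt (E : Event X C) (z : ℕ → X × C × C) (t : ℕ) (c : C) : ℝ :=
  (E (transcript z t) (z t).1 c : ℝ)

/-- The value `σ * E(π, x, c) * (c i - y i)` of the expert `k = (i, σ, E)` in round `t`, for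
prediction `c` and outcome `y`. -/
def expertGain {𝓔 : Finset (Event X C)} (z : ℕ → X × C × C) (t : ℕ) (k : EventExpert 𝓔)
    (c y : C) : ℝ :=
  ((k.2.1 : ℤ) : ℝ) * eventAt k.2.2.1 z t c * (c.1 k.1 - y.1 k.1)

/-- The realized gains of the experts in round `t` of `z`. -/
def realizedGain (𝓔 : Finset (Event X C)) (z : ℕ → X × C × C) (t : ℕ) (k : EventExpert 𝓔) : ℝ :=
  expertGain z t k (z t).2.1 (z t).2.2

/-- The payoff of the game of round `t`, when the learner predicts `c` and the outcome is `y`: the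
expected gain of MsMwC, run on the realized gains of the earlier rounds.  It depends on the triples
of the earlier rounds and on the context of round `t` only. -/
noncomputable def roundPayoff (T : ℕ) (𝓔 : Finset (Event X C)) (z : ℕ → X × C × C) (t : ℕ)
    (c y : C) : ℝ :=
  ∑ k : EventExpert 𝓔, msMwC T (realizedGain 𝓔 z) t k * expertGain z t k c y

/-- `N` is an `ε`-net of `C` in the sup norm. -/
def IsSupNet (ε : ℝ) (N : Finset C) : Prop :=
  ∀ c : C, ∃ c' ∈ N, ‖c'.1 - c.1‖ ≤ ε

/-- `ψ` restricts to a probability distribution on the finite set `N`. -/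
def IsDistributionOn (N : Finset C) (ψ : C → ℝ) : Prop :=
  (∀ c ∈ N, 0 ≤ ψ c) ∧ ∑ c ∈ N, ψ c = 1

/-- The worst-case expected payoff of the mixed strategy `ψ` on `N`. -/
noncomputable def worstCase (N : Finset C) (u : C → C → ℝ) (ψ : C → ℝ) : ℝ :=
  ⨆ y : C, ∑ c ∈ N, ψ c * u c y

/-- `ψ` is an `ε`-approximate minimax strategy of the game with payoff `u`, in which the minimizing
learner plays distributions on `N` and the maximizing adversary plays points of `C`. -/
def IsApproxMinimax (N : Finset C) (u : C → C → ℝ) (ε : ℝ) (ψ : C → ℝ) : Prop :=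
  IsDistributionOn N ψ ∧ ∀ ψ', IsDistributionOn N ψ' → worstCase N u ψ ≤ worstCase N u ψ' + ε

end Prediction

/-! ### One mirror descent step: optimality, stability, learning rates. -/

section Regret

variable {κ : Type*} [Fintype κ]

/-! The signed bias on an event is the cumulative gain of one expert. Hence the bias is at most the
gain of MsMwC plus its regret to the experts of signs `1` and `-1`, and it remains to bound both.

Regret holds path by path (`msMwC_regret`) and scales with the expert's own sum of squared gains, at
most the sum of `E ^ 2`. In each mirror descent step the optimality of the minimizer yields a
three-point inequality. The second-order correction pays for the movement of the iterate and for
part of the change of rates (`coordinate_stability`). The rest of that change is harmless because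
the comparator sits at the floor `1 / (n * T)` off its expert (`sum_rate_mul_log_le`).

The gain of MsMwC is the sum of the game payoffs. Had the learner known `y`, a net point near `y`
would make the payoff small, so Sion's theorem gives one distribution that is good against all `y`.
Net error and approximation error together give `2 / t` in round `t` (`sum_mul_roundPayoff_le`). As
`y_t` is fixed before `p_t` is drawn, this bounds the expected payoff. The harmonic sum is of order
`log T`, and Jensen moves the expectation inside the square root.

Measurability of the payoff is proved from continuity of MsMwC in the gains, its minimizers being
unique. -/

theorem mul_log_div_sub_add_pos {x y : ℝ} (hx : 0 < x) (hy : 0 < y) (hxy : x ≠ y) :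
    0 < x * Real.log (x / y) - x + y := by
  have h1 : Real.log (y / x) < y / x - 1 :=
    Real.log_lt_sub_one_of_pos (by positivity) fun h => hxy ((div_eq_one_iff_eq hx.ne').1 h).symm
  have h2 : Real.log (x / y) = -Real.log (y / x) := by rw [← Real.log_inv, inv_div]
  have h3 := mul_lt_mul_of_pos_left h1 hx
  have h4 : x * (y / x - 1) = y - x := by field_simp
  rw [h2]; linarith

theorem mul_log_div_sub_add_nonneg {x y : ℝ} (hx : 0 < x) (hy : 0 < y) :
    0 ≤ x * Real.log (x / y) - x + y := by
  rcases eq_or_ne x y with rfl | h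
  · simp [div_self hx.ne']
  · exact (mul_log_div_sub_add_pos hx hy h).le

theorem weightedEntropyDiv_nonneg {η w w' : κ → ℝ} (hη : ∀ k, 0 < η k) (hw : ∀ k, 0 < w k)
    (hw' : ∀ k, 0 < w' k) : 0 ≤ weightedEntropyDiv η w w' :=
  Finset.sum_nonneg fun k _ =>
    mul_nonneg (one_div_pos.2 (hη k)).le (mul_log_div_sub_add_nonneg (hw k) (hw' k))

theorem weightedEntropyDiv_pos {η w w' : κ → ℝ} (hη : ∀ k, 0 < η k) (hw : ∀ k, 0 < w k)
    (hw' : ∀ k, 0 < w' k) (hne : w ≠ w') : 0 < weightedEntropyDiv η w w' := by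
  obtain ⟨k, hk⟩ := Function.ne_iff.1 hne
  exact Finset.sum_pos' (fun k _ =>
    mul_nonneg (one_div_pos.2 (hη k)).le (mul_log_div_sub_add_nonneg (hw k) (hw' k)))
    ⟨k, Finset.mem_univ k, mul_pos (one_div_pos.2 (hη k)) (mul_log_div_sub_add_pos (hw k) (hw' k) hk)⟩

theorem HasDerivAt.nonneg_of_forall_le {h : ℝ → ℝ} {h' : ℝ} (hd : HasDerivAt h h' 0)
    (hmin : ∀ s ∈ Set.Icc (0 : ℝ) 1, h 0 ≤ h s) : 0 ≤ h' := by
  have h1 := hd.tendsto_slope_zero_right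
  refine ge_of_tendsto h1 ?_
  filter_upwards [Ioc_mem_nhdsGT (zero_lt_one' ℝ)] with s hs
  have := hmin s ⟨hs.1.le, hs.2⟩
  simp only [zero_add, smul_eq_mul]
  exact mul_nonneg (inv_nonneg.2 hs.1.le) (sub_nonneg.2 this)

theorem convex_truncatedSimplex (δ : ℝ) : Convex ℝ (truncatedSimplex κ δ) := by
  refine (convex_stdSimplex ℝ κ).inter fun x hx y hy a b ha hb hab k => ?_
  have h1 := mul_le_mul_of_nonneg_left (hx k) ha
  have h2 := mul_le_mul_of_nonneg_left (hy k) hb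
  simp only [Pi.add_apply, Pi.smul_apply, smul_eq_mul]
  calc δ = a * δ + b * δ := by rw [← add_mul, hab, one_mul]
    _ ≤ _ := add_le_add h1 h2

theorem hasDerivAt_stepObjective_line (η q g w v : κ → ℝ) (hq : ∀ k, 0 < q k)
    (hw : ∀ k, 0 < w k) :
    HasDerivAt (fun s : ℝ => stepObjective η q g (w + s • v))
      (∑ k, v k * (-g k + 32 * η k * g k ^ 2) +
        ∑ k, 1 / η k * (v k * Real.log (w k / q k))) 0 := by
  have hx : ∀ k, HasDerivAt (fun s : ℝ => w k + s * v k) (v k) 0 := fun k => by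
    simpa using ((hasDerivAt_id (0 : ℝ)).mul_const (v k)).const_add (w k)
  unfold stepObjective weightedEntropyDiv
  simp only [Pi.add_apply, Pi.smul_apply, smul_eq_mul]
  refine HasDerivAt.add (HasDerivAt.fun_sum fun k _ => (hx k).mul_const _)
    (HasDerivAt.fun_sum fun k _ => HasDerivAt.const_mul _ ?_)
  have hlog : HasDerivAt (fun s : ℝ => Real.log ((w k + s * v k) / q k))
      (v k / q k / ((w k + 0 * v k) / q k)) 0 := by
    refine ((hx k).div_const (q k)).log ?_
    have := hw k; have := hq k
    simp only [zero_mul, add_zero]; positivity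
  have h := (((hx k).fun_mul hlog).sub (hx k)).add_const (q k)
  refine h.congr_deriv ?_
  have := (hw k).ne'; have := (hq k).ne'
  simp only [zero_mul, add_zero]
  field_simp
  ring

/-- The minimizer of a mirror descent step satisfies a three-point inequality. -/
theorem stepObjective_add_div_le {η q g w u : κ → ℝ} {δ : ℝ} (hδ : 0 < δ)
    (hq : ∀ k, 0 < q k) (hw : w ∈ truncatedSimplex κ δ)
    (hmin : IsMinOn (stepObjective η q g) (truncatedSimplex κ δ) w)
    (hu : u ∈ truncatedSimplex κ δ) :
    stepObjective η q g w + weightedEntropyDiv η u w ≤ stepObjective η q g u := by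
  have hwp : ∀ k, 0 < w k := fun k => hδ.trans_le (hw.2 k)
  have hup : ∀ k, 0 < u k := fun k => hδ.trans_le (hu.2 k)
  -- First-order optimality: the derivative at `w` towards `u` is nonnegative. It equals the gap in
  -- the three-point inequality.
  have h := (hasDerivAt_stepObjective_line η q g w (u - w) hq hwp).nonneg_of_forall_le
    fun s hs => by
      have := hmin ((convex_truncatedSimplex δ).add_smul_sub_mem hw hu hs)
      simpa using this
  have key : stepObjective η q g u - stepObjective η q g w - weightedEntropyDiv η u w =
      ∑ k, (u - w) k * (-g k + 32 * η k * g k ^ 2) +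
        ∑ k, 1 / η k * ((u - w) k * Real.log (w k / q k)) := by
    unfold stepObjective weightedEntropyDiv
    rw [← Finset.sum_add_distrib, ← Finset.sum_add_distrib, ← Finset.sum_add_distrib,
      ← Finset.sum_sub_distrib, ← Finset.sum_sub_distrib]
    refine Finset.sum_congr rfl fun k _ => ?_
    rw [Real.log_div (hup k).ne' (hq k).ne', Real.log_div (hwp k).ne' (hq k).ne',
      Real.log_div (hup k).ne' (hwp k).ne', Pi.sub_apply]
    ring
  linarith

/-- The three-point inequality separates the values at two distinct minimizers by a positive
divergence. -/
theorem isMinOn_stepObjective_unique {η q g w w' : κ → ℝ} {δ : ℝ} (hδ : 0 < δ)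
    (hη : ∀ k, 0 < η k) (hq : ∀ k, 0 < q k) (hw : w ∈ truncatedSimplex κ δ)
    (hmin : IsMinOn (stepObjective η q g) (truncatedSimplex κ δ) w)
    (hw' : w' ∈ truncatedSimplex κ δ)
    (hmin' : IsMinOn (stepObjective η q g) (truncatedSimplex κ δ) w') : w' = w := by
  by_contra hne
  have h1 := stepObjective_add_div_le hδ hq hw hmin hw'
  have h2 := weightedEntropyDiv_pos hη (fun k => hδ.trans_le (hw'.2 k))
    (fun k => hδ.trans_le (hw.2 k)) hne
  have h3 := isMinOn_iff.1 hmin' w hw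
  linarith

/-- The stability estimate for one coordinate: the conjugate of the entropy is quadratic near `0`. -/
theorem sub_mul_sub_entropy_le {q w x R : ℝ} (hq : 0 < q) (hw : 0 < w) (hR : 0 < R)
    (hx : |x| ≤ R) :
    (q - w) * x - R * (w * Real.log (w / q) - w + q) ≤ q * x ^ 2 / R := by
  -- The left side is largest at `w = q * exp s`. Comparison with that point uses `log r ≤ r - 1`
  -- for `r = q * exp s / w`, then `exp s ≤ 1 + s + s ^ 2` for `|s| ≤ 1`.
  set s : ℝ := -(x / R) with hs
  have hs1 : |s| ≤ 1 := by
    rw [hs, abs_neg, abs_div, abs_of_pos hR]; exact (div_le_one hR).2 hx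
  have hexp := (abs_le.1 (Real.abs_exp_sub_one_sub_id_le hs1)).2
  have h1 : 0 ≤ w * (q * Real.exp s / w - 1 - Real.log (q * Real.exp s / w)) := by
    have := Real.log_le_sub_one_of_pos (x := q * Real.exp s / w) (by positivity)
    exact mul_nonneg hw.le (by linarith)
  rw [Real.log_div (by positivity) hw.ne', Real.log_mul hq.ne' (Real.exp_pos s).ne',
    Real.log_exp] at h1
  have h2 : w * (q * Real.exp s / w - 1 - (Real.log q + s - Real.log w)) =
      q * Real.exp s - w - w * s + w * (Real.log w - Real.log q) := by
    field_simp; ring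
  rw [h2] at h1
  rw [Real.log_div hw.ne' hq.ne']
  have h3 : q * Real.exp s ≤ q * (1 + s + s ^ 2) := mul_le_mul_of_nonneg_left (by linarith) hq.le
  have h4 : 0 ≤ R * (q * (1 + s + s ^ 2) - w - w * s + w * (Real.log w - Real.log q)) :=
    mul_nonneg hR.le (by linarith)
  have h5 : x = -(R * s) := by rw [hs]; field_simp
  have h6 : q * x ^ 2 / R = R * (q * s ^ 2) := by rw [h5]; field_simp
  rw [h6, h5]
  nlinarith

/-- The drift `(R' - R) * w` is absorbed into the loss. With `y = g ^ 2 / R`, stability then costs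
at most `q * (9 / 4 + 2) * y`, well below the available `32 * q * y`. -/
theorem coordinate_stability {q w g R R' : ℝ} (hq : 0 < q) (hw : 0 < w) (hg : |g| ≤ 1)
    (hR : 64 ≤ R) (hRR' : R ≤ R') (hR' : R' ≤ R + 2 * g ^ 2 / R) :
    (q - w) * (-g + 32 * (1 / R) * g ^ 2) - R * (w * Real.log (w / q) - w + q) + (R' - R) * w ≤
      q * (32 * (1 / R) * g ^ 2) := by
  have hR0 : 0 < R := by linarith
  set c := R' - R with hc
  set y := g ^ 2 / R with hy
  have hy0 : 0 ≤ y := by positivity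
  have hg2 : g ^ 2 = |g| ^ 2 := (sq_abs g).symm
  have hyg : 64 * y ≤ |g| := by
    have h1 : y * R = g ^ 2 := by rw [hy]; field_simp
    have h2 : g ^ 2 ≤ |g| := by rw [hg2]; nlinarith [abs_nonneg g]
    nlinarith
  have ha : 32 * (1 / R) * g ^ 2 = 32 * y := by rw [hy]; ring
  have hc2 : c ≤ 2 * y := by rw [hy]; have : 2 * g ^ 2 / R = 2 * (g ^ 2 / R) := by ring
                             linarith
  have hc0 : 0 ≤ c := by linarith
  set x := -g + 32 * y - c with hx
  have hxabs : |x| ≤ 3 / 2 * |g| := by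
    rw [abs_le]; constructor <;> rw [hx] <;> linarith [neg_abs_le g, le_abs_self g]
  have h1 := sub_mul_sub_entropy_le hq hw hR0 (x := x) (by linarith)
  have h2 : x ^ 2 ≤ 9 / 4 * g ^ 2 := by
    rw [← sq_abs x, hg2]; nlinarith [abs_nonneg x, abs_nonneg g]
  have h3 : q * x ^ 2 / R ≤ q * (9 / 4 * y) := by
    rw [hy, mul_div_assoc]
    refine mul_le_mul_of_nonneg_left ?_ hq.le
    rw [← mul_div_assoc]
    exact div_le_div_of_nonneg_right h2 hR0.le
  rw [ha]
  have h4 : q * c ≤ q * (2 * y) := mul_le_mul_of_nonneg_left hc2 hq.le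
  have h5 : 0 ≤ q * y := by positivity
  have h6 : (q - w) * (-g + 32 * y) = (q - w) * x + q * c - c * w := by rw [hx]; ring
  rw [h6]
  linarith

/-- The reciprocal of `learningRate`. -/
noncomputable def inverseRate (T : ℕ) (g : ℕ → κ → ℝ) (t : ℕ) (k : κ) : ℝ :=
  max 64 (√((∑ s ∈ Finset.range t, g s k ^ 2) / Real.log (Fintype.card κ * T)))

theorem inverseRate_ge (T : ℕ) (g : ℕ → κ → ℝ) (t : ℕ) (k : κ) : 64 ≤ inverseRate T g t k :=
  le_max_left _ _

theorem learningRate_pos (T : ℕ) (g : ℕ → κ → ℝ) (t : ℕ) (k : κ) : 0 < learningRate T g t k :=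
  one_div_pos.2 (lt_of_lt_of_le (by norm_num) (inverseRate_ge T g t k))

theorem half_le_log_card_mul (hκ : 2 ≤ Fintype.card κ) {T : ℕ} (hT : 1 ≤ T) :
    1 / 2 ≤ Real.log (Fintype.card κ * T) := by
  have h1 : (2 : ℝ) ≤ Fintype.card κ := by exact_mod_cast hκ
  have h2 : (1 : ℝ) ≤ T := by exact_mod_cast hT
  have h3 : Real.log 2 ≤ Real.log (Fintype.card κ * T) :=
    Real.log_le_log (by norm_num) (by nlinarith)
  linarith [Real.log_two_gt_d9]

theorem inverseRate_mono (hκ : 2 ≤ Fintype.card κ) {T : ℕ} (hT : 1 ≤ T) (g : ℕ → κ → ℝ) (t : ℕ)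
    (k : κ) : inverseRate T g t k ≤ inverseRate T g (t + 1) k := by
  have hL := half_le_log_card_mul hκ hT
  refine max_le_max le_rfl (Real.sqrt_le_sqrt (div_le_div_of_nonneg_right ?_ (by linarith)))
  rw [Finset.sum_range_succ]
  linarith [sq_nonneg (g t k)]

theorem sum_sq_le_inverseRate (hκ : 2 ≤ Fintype.card κ) {T : ℕ} (hT : 1 ≤ T) (g : ℕ → κ → ℝ)
    (t : ℕ) (k : κ) :
    ∑ s ∈ Finset.range t, g s k ^ 2 ≤
      inverseRate T g t k ^ 2 * Real.log (Fintype.card κ * T) := by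
  have hL := half_le_log_card_mul hκ hT
  have hV : 0 ≤ ∑ s ∈ Finset.range t, g s k ^ 2 := Finset.sum_nonneg fun s _ => sq_nonneg _
  rw [← div_le_iff₀ (by linarith)]
  have hR := inverseRate_ge T g t k
  have h : √((∑ s ∈ Finset.range t, g s k ^ 2) / Real.log (Fintype.card κ * T)) ≤
      inverseRate T g t k := le_max_right _ _
  exact (Real.sqrt_le_left (by linarith)).1 h

/-- Squaring the right side adds at least `4 * g ^ 2` to `R ^ 2`, which suffices since the logarithm
is at least `1 / 2`. -/
theorem inverseRate_succ_le (hκ : 2 ≤ Fintype.card κ) {T : ℕ} (hT : 1 ≤ T) (g : ℕ → κ → ℝ)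
    (t : ℕ) (k : κ) :
    inverseRate T g (t + 1) k ≤ inverseRate T g t k + 2 * g t k ^ 2 / inverseRate T g t k := by
  have hL := half_le_log_card_mul hκ hT
  have hV := sum_sq_le_inverseRate hκ hT g t k
  have hR := inverseRate_ge T g t k
  have h0 : 0 ≤ 2 * g t k ^ 2 / inverseRate T g t k := by positivity
  refine max_le (by linarith) (Real.sqrt_le_iff.2 ⟨by linarith, ?_⟩)
  rw [div_le_iff₀ (by linarith), Finset.sum_range_succ]
  have h1 : inverseRate T g t k ^ 2 + 4 * g t k ^ 2 ≤
      (inverseRate T g t k + 2 * g t k ^ 2 / inverseRate T g t k) ^ 2 := by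
    have : inverseRate T g t k * (2 * g t k ^ 2 / inverseRate T g t k) = 2 * g t k ^ 2 := by
      field_simp
    nlinarith
  have h2 := mul_le_mul_of_nonneg_right h1
    (show 0 ≤ Real.log (Fintype.card κ * T) by linarith)
  nlinarith [sq_nonneg (g t k)]

/-- Telescoping of square roots: with `X`, `Y` the roots of consecutive partial sums, `g ^ 2 = (X -
Y) * (X + Y)` and `X + Y ≤ 4 * R * √L`. -/
theorem sum_sq_div_inverseRate_le (hκ : 2 ≤ Fintype.card κ) {T : ℕ} (hT : 1 ≤ T)
    (g : ℕ → κ → ℝ) (hg : ∀ t k, |g t k| ≤ 1) (t : ℕ) (k : κ) :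
    ∑ s ∈ Finset.range t, g s k ^ 2 / inverseRate T g s k ≤
      4 * √(Real.log (Fintype.card κ * T) * ∑ s ∈ Finset.range t, g s k ^ 2) := by
  have hL := half_le_log_card_mul hκ hT
  rw [Real.sqrt_mul (by linarith)]
  induction t with
  | zero => simp
  | succ t ih =>
    rw [Finset.sum_range_succ]
    have hV := sum_sq_le_inverseRate hκ hT g t k
    have hR := inverseRate_ge T g t k
    have hV0 : 0 ≤ ∑ s ∈ Finset.range t, g s k ^ 2 := Finset.sum_nonneg fun s _ => sq_nonneg _
    have hsum := Finset.sum_range_succ (fun s => g s k ^ 2) t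
    have hV0' : 0 ≤ ∑ s ∈ Finset.range (t + 1), g s k ^ 2 := Finset.sum_nonneg fun s _ => sq_nonneg _
    have hg1 : g t k ^ 2 ≤ 1 := by rw [← sq_abs]; nlinarith [abs_nonneg (g t k), hg t k]
    set R := inverseRate T g t k
    set L := Real.log (Fintype.card κ * T)
    have hX := Real.sq_sqrt hV0'
    have hY := Real.sq_sqrt hV0
    have hs := Real.sq_sqrt (show 0 ≤ L by linarith)
    have hXY : √(∑ s ∈ Finset.range t, g s k ^ 2) ≤ √(∑ s ∈ Finset.range (t + 1), g s k ^ 2) :=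
      Real.sqrt_le_sqrt (by rw [hsum]; linarith [sq_nonneg (g t k)])
    have hX2 : √(∑ s ∈ Finset.range (t + 1), g s k ^ 2) ≤ 2 * R * √L := by
      refine Real.sqrt_le_iff.2 ⟨by positivity, ?_⟩
      rw [mul_pow, hs, hsum]
      nlinarith
    have hY0 := Real.sqrt_nonneg (∑ s ∈ Finset.range t, g s k ^ 2)
    set X := √(∑ s ∈ Finset.range (t + 1), g s k ^ 2)
    set Y := √(∑ s ∈ Finset.range t, g s k ^ 2)
    have h1 : g t k ^ 2 / R ≤ 4 * (√L * (X - Y)) := by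
      rw [div_le_iff₀ (by linarith)]
      have e : g t k ^ 2 = (X - Y) * (X + Y) := by nlinarith
      rw [e]
      have := mul_le_mul_of_nonneg_left (show X + Y ≤ 4 * R * √L by linarith)
        (sub_nonneg.2 hXY)
      linarith
    linarith

theorem msMwC_mem [Nonempty κ] {T : ℕ} (hT : 1 ≤ T) (g : ℕ → κ → ℝ) (t : ℕ) :
    msMwC T g t ∈ truncatedSimplex κ (1 / (Fintype.card κ * T)) := by
  cases t with
  | zero =>
    have hn : (0 : ℝ) < Fintype.card κ := by exact_mod_cast Fintype.card_pos
    have hT' : (1 : ℝ) ≤ T := by exact_mod_cast hT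
    refine ⟨⟨fun _ => ?_, ?_⟩, fun _ => ?_⟩
    · simp only [msMwC]; positivity
    · simp [msMwC, Finset.sum_const, hn.ne']
    · exact one_div_le_one_div_of_le hn (by nlinarith)
  | succ t => exact (msMwC_succ_spec hT g t).1

theorem truncation_pos [Nonempty κ] {T : ℕ} (hT : 1 ≤ T) :
    (0 : ℝ) < 1 / (Fintype.card κ * T) := by
  have hn : (0 : ℝ) < Fintype.card κ := by exact_mod_cast Fintype.card_pos
  have hT' : (0 : ℝ) < T := by exact_mod_cast hT
  positivity

theorem msMwC_pos [Nonempty κ] {T : ℕ} (hT : 1 ≤ T) (g : ℕ → κ → ℝ) (t : ℕ) (k : κ) :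
    0 < msMwC T g t k :=
  (truncation_pos hT).trans_le ((msMwC_mem hT g t).2 k)

end Regret

/-! ### The regret bound of MsMwC. -/

section RegretBound

variable {κ : Type*} [Fintype κ]

/-- One step of mirror descent with rates changing from `1 / R` to `1 / R'`. -/
theorem step_regret_le {R R' g q w u : κ → ℝ} {δ : ℝ} (hδ : 0 < δ)
    (hR : ∀ k, 64 ≤ R k) (hRR' : ∀ k, R k ≤ R' k) (hR' : ∀ k, R' k ≤ R k + 2 * g k ^ 2 / R k)
    (hg : ∀ k, |g k| ≤ 1) (hq : ∀ k, 0 < q k) (hw : w ∈ truncatedSimplex κ δ)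
    (hmin : IsMinOn (stepObjective (fun k => 1 / R k) q g) (truncatedSimplex κ δ) w)
    (hu : u ∈ truncatedSimplex κ δ) :
    ∑ k, u k * g k - ∑ k, q k * g k ≤ ∑ k, u k * (32 * (1 / R k) * g k ^ 2) +
      weightedEntropyDiv (fun k => 1 / R k) u q - weightedEntropyDiv (fun k => 1 / R' k) u w +
      ∑ k, (R' k - R k) * (u k * Real.log (u k / w k)) := by
  have h1 := stepObjective_add_div_le hδ hq hw hmin hu
  have h2 : ∑ k, ((q k - w k) * (-g k + 32 * (1 / R k) * g k ^ 2) -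
        R k * (w k * Real.log (w k / q k) - w k + q k) + (R' k - R k) * w k) ≤
      ∑ k, q k * (32 * (1 / R k) * g k ^ 2) :=
    Finset.sum_le_sum fun k _ => coordinate_stability (hq k) (hδ.trans_le (hw.2 k)) (hg k) (hR k)
      (hRR' k) (hR' k)
  -- Changing rates in the divergence adds `(R' - R) * (u * log (u / w) - u + w)`. The `-u` part is
  -- dropped, and `h2` has absorbed the `w` part.
  have h3 : 0 ≤ ∑ k, (R' k - R k) * u k := Finset.sum_nonneg fun k _ =>
    mul_nonneg (sub_nonneg.2 (hRR' k)) (hδ.trans_le (hu.2 k)).le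
  have key : ∑ k, u k * (32 * (1 / R k) * g k ^ 2) +
      weightedEntropyDiv (fun k => 1 / R k) u q - weightedEntropyDiv (fun k => 1 / R' k) u w +
      ∑ k, (R' k - R k) * (u k * Real.log (u k / w k)) - (∑ k, u k * g k - ∑ k, q k * g k) =
      (stepObjective (fun k => 1 / R k) q g u - stepObjective (fun k => 1 / R k) q g w -
        weightedEntropyDiv (fun k => 1 / R k) u w) +
      (∑ k, q k * (32 * (1 / R k) * g k ^ 2) -
        ∑ k, ((q k - w k) * (-g k + 32 * (1 / R k) * g k ^ 2) -
        R k * (w k * Real.log (w k / q k) - w k + q k) + (R' k - R k) * w k)) +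
      ∑ k, (R' k - R k) * u k := by
    simp only [stepObjective, weightedEntropyDiv, ← Finset.sum_add_distrib,
      ← Finset.sum_sub_distrib, one_div_one_div]
    refine Finset.sum_congr rfl fun k _ => ?_
    ring
  linarith

theorem truncated_mul_log_div_le [Nonempty κ] {T : ℕ} (hT : 1 ≤ T) {u w : κ → ℝ}
    (hu : u ∈ truncatedSimplex κ (1 / (Fintype.card κ * T)))
    (hw : w ∈ truncatedSimplex κ (1 / (Fintype.card κ * T))) (k : κ) :
    u k * Real.log (u k / w k) ≤ u k * Real.log (Fintype.card κ * T) := by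
  have hδ := truncation_pos (κ := κ) hT
  have hup := hδ.trans_le (hu.2 k)
  have hwp := hδ.trans_le (hw.2 k)
  have hu1 : u k ≤ 1 := by
    rw [← hu.1.2]
    exact Finset.single_le_sum (fun j _ => hu.1.1 j) (Finset.mem_univ k)
  refine mul_le_mul_of_nonneg_left (Real.log_le_log (by positivity) ?_) hup.le
  rw [div_le_iff₀ hwp]
  have h := hw.2 k
  rw [div_le_iff₀ (by rwa [one_div_pos] at hδ)] at h
  linarith

theorem weightedEntropyDiv_initial_le [Nonempty κ] {T : ℕ} (hT : 1 ≤ T)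
    (g : ℕ → κ → ℝ) {u : κ → ℝ} (hu : u ∈ truncatedSimplex κ (1 / (Fintype.card κ * T))) :
    weightedEntropyDiv (learningRate T g 0) u (msMwC T g 0) ≤
      64 * Real.log (Fintype.card κ * T) := by
  have hη : ∀ k, 1 / learningRate T g 0 k = 64 := fun k => by simp [learningRate]
  have hw := msMwC_mem hT g 0
  unfold weightedEntropyDiv
  simp only [hη]
  rw [← Finset.mul_sum]
  refine mul_le_mul_of_nonneg_left ?_ (by norm_num)
  rw [Finset.sum_add_distrib, Finset.sum_sub_distrib, hu.1.2, hw.1.2, sub_add_cancel]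
  refine (Finset.sum_le_sum fun k _ => truncated_mul_log_div_le hT hu hw k).trans ?_
  rw [← Finset.sum_mul, hu.1.2, one_mul]

/-- The comparator used for the regret against expert `k`. -/
noncomputable def mixedComparator (κ : Type*) [Fintype κ] [DecidableEq κ] (T : ℕ) (k j : κ) : ℝ :=
  (1 - 1 / T) * (if j = k then 1 else 0) + 1 / (Fintype.card κ * T)

variable [DecidableEq κ]

theorem sum_mixedComparator_mul (T : ℕ) (k : κ) (f : κ → ℝ) :
    ∑ j, mixedComparator κ T k j * f j =
      (1 - 1 / T) * f k + 1 / (Fintype.card κ * T) * ∑ j, f j := by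
  simp [mixedComparator, add_mul, Finset.sum_add_distrib, Finset.mul_sum]

theorem mixedComparator_mem [Nonempty κ] {T : ℕ} (hT : 1 ≤ T) (k : κ) :
    mixedComparator κ T k ∈ truncatedSimplex κ (1 / (Fintype.card κ * T)) := by
  have hδ := truncation_pos (κ := κ) hT
  have hT' : (1 : ℝ) ≤ T := by exact_mod_cast hT
  have hn : (0 : ℝ) < Fintype.card κ := by exact_mod_cast Fintype.card_pos
  have h1 : 0 ≤ 1 - 1 / (T : ℝ) := sub_nonneg.2 ((div_le_one (by linarith)).2 hT')
  have h2 : ∀ j, 1 / (Fintype.card κ * T : ℝ) ≤ mixedComparator κ T k j := fun j => by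
    unfold mixedComparator
    split_ifs <;> linarith
  refine ⟨⟨fun j => hδ.le.trans (h2 j), ?_⟩, h2⟩
  have := sum_mixedComparator_mul T k fun _ => (1 : ℝ)
  simp only [mul_one] at this
  rw [this]
  simp only [Finset.sum_const, Finset.card_univ, nsmul_eq_mul, mul_one]
  field_simp
  ring

/-- Only mass `1 / T` is moved to the uniform distribution, so over `T` rounds the mixing costs a
constant. -/
theorem abs_sum_mixedComparator_sub_le [Nonempty κ] {T : ℕ} (hT : 1 ≤ T) (k : κ) {f : κ → ℝ}
    {B : ℝ} (hf : ∀ j, |f j| ≤ B) :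
    |∑ j, mixedComparator κ T k j * f j - f k| ≤ 2 * B / T := by
  have hT' : (0 : ℝ) < T := by exact_mod_cast hT
  have hn : (0 : ℝ) < Fintype.card κ := by exact_mod_cast Fintype.card_pos
  have h1 : |∑ j, f j| ≤ Fintype.card κ * B :=
    (Finset.abs_sum_le_sum_abs _ _).trans ((Finset.sum_le_sum fun j _ => hf j).trans (by simp))
  have h2 : ∑ j, mixedComparator κ T k j * f j - f k =
      ((∑ j, f j) / Fintype.card κ - f k) / T := by
    rw [sum_mixedComparator_mul]; field_simp; ring
  rw [h2, abs_div, abs_of_pos hT']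
  refine div_le_div_of_nonneg_right ((abs_sub _ _).trans ?_) hT'.le
  rw [abs_div, abs_of_pos hn]
  have h3 : |∑ j, f j| / Fintype.card κ ≤ B := (div_le_iff₀ hn).2 (by linarith)
  linarith [hf k]

/-- Off `k` the comparator is at the floor, hence below `w`, and its logarithms are nonpositive.
Thus only the rate of `k` enters the regret. -/
theorem sum_rate_mul_log_le [Nonempty κ] {T : ℕ} (hT : 1 ≤ T) (k : κ) {c w : κ → ℝ}
    (hL : 0 ≤ Real.log (Fintype.card κ * T)) (hc : ∀ j, 0 ≤ c j)
    (hw : w ∈ truncatedSimplex κ (1 / (Fintype.card κ * T))) :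
    ∑ j, c j * (mixedComparator κ T k j * Real.log (mixedComparator κ T k j / w j)) ≤
      Real.log (Fintype.card κ * T) * c k := by
  have hu := mixedComparator_mem hT k
  have hδ := truncation_pos (κ := κ) hT
  have hterm : ∀ j, c j * (mixedComparator κ T k j * Real.log (mixedComparator κ T k j / w j)) ≤
      if j = k then Real.log (Fintype.card κ * T) * c k else 0 := fun j => by
    have hup := hδ.trans_le (hu.2 j)
    have hwp := hδ.trans_le (hw.2 j)
    split_ifs with h
    · subst h
      have h1 := truncated_mul_log_div_le hT hu hw j
      have hu1 : mixedComparator κ T j j ≤ 1 :=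
        (Finset.single_le_sum (fun j _ => hu.1.1 j) (Finset.mem_univ j)).trans_eq hu.1.2
      have h2 := mul_le_mul_of_nonneg_left
        (h1.trans (mul_le_of_le_one_left hL hu1)) (hc j)
      linarith
    · refine mul_nonpos_of_nonneg_of_nonpos (hc j) (mul_nonpos_of_nonneg_of_nonpos hup.le ?_)
      refine Real.log_nonpos (by positivity) ((div_le_one hwp).2 ?_)
      have h2 : mixedComparator κ T k j = 1 / (Fintype.card κ * T) := by
        simp [mixedComparator, h]
      rw [h2]; exact hw.2 j
  exact (Finset.sum_le_sum fun j _ => hterm j).trans (by simp)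

/-- The regret of MsMwC against the mixed comparator, before bounding the correction terms. -/
theorem msMwC_regret_mixedComparator [Nonempty κ] (hκ : 2 ≤ Fintype.card κ) {T : ℕ} (hT : 1 ≤ T)
    {g : ℕ → κ → ℝ} (hg : ∀ t k, |g t k| ≤ 1) (k : κ) (t : ℕ) :
    ∑ s ∈ Finset.range t, (∑ j, mixedComparator κ T k j * g s j - ∑ j, msMwC T g s j * g s j) ≤
      ∑ s ∈ Finset.range t,
        ∑ j, mixedComparator κ T k j * (32 * (1 / inverseRate T g s j) * g s j ^ 2) +
      weightedEntropyDiv (learningRate T g 0) (mixedComparator κ T k) (msMwC T g 0) -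
      weightedEntropyDiv (learningRate T g t) (mixedComparator κ T k) (msMwC T g t) +
      Real.log (Fintype.card κ * T) * (inverseRate T g t k - inverseRate T g 0 k) := by
  have hL := half_le_log_card_mul hκ hT
  induction t with
  | zero => simp
  | succ t ih =>
    rw [Finset.sum_range_succ, Finset.sum_range_succ]
    have h1 := step_regret_le (truncation_pos hT) (inverseRate_ge T g t)
      (inverseRate_mono hκ hT g t) (inverseRate_succ_le hκ hT g t) (hg t)
      (msMwC_pos hT g t) (msMwC_succ_spec hT g t).1 (msMwC_succ_spec hT g t).2
      (mixedComparator_mem hT k)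
    have h2 := sum_rate_mul_log_le hT k (c := fun j => inverseRate T g (t + 1) j -
      inverseRate T g t j) (by linarith)
      (fun j => sub_nonneg.2 (inverseRate_mono hκ hT g t j)) (msMwC_mem hT g (t + 1))
    have e1 : (fun j => 1 / inverseRate T g t j) = learningRate T g t := rfl
    have e2 : (fun j => 1 / inverseRate T g (t + 1) j) = learningRate T g (t + 1) := rfl
    rw [e1, e2] at h1
    linarith

/-- The regret bound of MsMwC. -/
theorem msMwC_regret [Nonempty κ] (hκ : 2 ≤ Fintype.card κ) {T : ℕ} (hT : 1 ≤ T)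
    {g : ℕ → κ → ℝ} (hg : ∀ t k, |g t k| ≤ 1) (k : κ) :
    ∑ t ∈ Finset.range T, g t k ≤ ∑ t ∈ Finset.range T, ∑ j, msMwC T g t j * g t j +
      (70 * Real.log (Fintype.card κ * T) +
        129 * √(Real.log (Fintype.card κ * T) * ∑ t ∈ Finset.range T, g t k ^ 2)) := by
  have hL := half_le_log_card_mul hκ hT
  have hT' : (0 : ℝ) < T := by exact_mod_cast hT
  have hu := mixedComparator_mem hT k
  have h1 := msMwC_regret_mixedComparator hκ hT hg k T
  have h2 := weightedEntropyDiv_initial_le hT g hu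
  have h3 : 0 ≤ weightedEntropyDiv (learningRate T g T) (mixedComparator κ T k) (msMwC T g T) :=
    weightedEntropyDiv_nonneg (learningRate_pos T g T)
      (fun j => (truncation_pos hT).trans_le (hu.2 j)) (msMwC_pos hT g T)
  have h4 : Real.log (Fintype.card κ * T) * (inverseRate T g T k - inverseRate T g 0 k) ≤
      √(Real.log (Fintype.card κ * T) * ∑ t ∈ Finset.range T, g t k ^ 2) := by
    have e0 : inverseRate T g 0 k = 64 := by simp [inverseRate]
    have e1 : inverseRate T g T k ≤ 64 +
        √((∑ s ∈ Finset.range T, g s k ^ 2) / Real.log (Fintype.card κ * T)) :=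
      max_le_add_of_nonneg (by norm_num) (Real.sqrt_nonneg _)
    have e2 : Real.log (Fintype.card κ * T) *
        √((∑ s ∈ Finset.range T, g s k ^ 2) / Real.log (Fintype.card κ * T)) =
        √(Real.log (Fintype.card κ * T) * ∑ t ∈ Finset.range T, g t k ^ 2) := by
      rw [Real.sqrt_div' _ (by linarith), Real.sqrt_mul (by linarith)]
      have hs := Real.mul_self_sqrt (show 0 ≤ Real.log (Fintype.card κ * T) by linarith)
      have hs0 : √(Real.log (Fintype.card κ * T)) ≠ 0 := (Real.sqrt_pos.2 (by linarith)).ne'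
      nth_rewrite 1 [← hs]
      field_simp
    rw [← e2, e0]
    exact mul_le_mul_of_nonneg_left (by linarith) (by linarith)
  have hT1 : ∀ B : ℝ, ∑ _t ∈ Finset.range T, B / (T : ℝ) = B := fun B => by
    simp only [Finset.sum_const, Finset.card_range, nsmul_eq_mul]; field_simp
  have h5 : ∑ s ∈ Finset.range T,
      ∑ j, mixedComparator κ T k j * (32 * (1 / inverseRate T g s j) * g s j ^ 2) ≤
      32 * ∑ s ∈ Finset.range T, g s k ^ 2 / inverseRate T g s k + 1 := by
    refine le_of_le_of_eq ?_ (congrArg (32 * _ + ·) (hT1 1))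
    rw [Finset.mul_sum, ← Finset.sum_add_distrib]
    refine Finset.sum_le_sum fun s _ => ?_
    have hb : ∀ j, |32 * (1 / inverseRate T g s j) * g s j ^ 2| ≤ 1 / 2 := fun j => by
      have hR := inverseRate_ge T g s j
      have hg2 : g s j ^ 2 ≤ 1 := by rw [← sq_abs]; nlinarith [abs_nonneg (g s j), hg s j]
      rw [abs_of_nonneg (by positivity)]
      have : 1 / inverseRate T g s j ≤ 1 / 64 := one_div_le_one_div_of_le (by norm_num) hR
      nlinarith [sq_nonneg (g s j)]
    have h := (abs_le.1 (abs_sum_mixedComparator_sub_le hT k hb)).2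
    have e : 32 * (1 / inverseRate T g s k) * g s k ^ 2 =
      32 * (g s k ^ 2 / inverseRate T g s k) := by ring
    rw [e, mul_one_div_cancel two_ne_zero] at h
    linarith
  have h6 := sum_sq_div_inverseRate_le hκ hT g hg T k
  have h7 : ∑ t ∈ Finset.range T, g t k - 2 ≤
      ∑ t ∈ Finset.range T, ∑ j, mixedComparator κ T k j * g t j := by
    rw [← hT1 2, ← Finset.sum_sub_distrib]
    refine Finset.sum_le_sum fun s _ => ?_
    have h := (abs_le.1 (abs_sum_mixedComparator_sub_le hT k (hg s))).1
    rw [mul_one] at h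
    linarith
  rw [Finset.sum_sub_distrib] at h1
  -- The constants: `64 * L` from the initial divergence and `1 + 2 ≤ 6 * L` from mixing give `70`;
  -- `32 * 4` from the correction and `1` from the rate change give `129`.
  linarith

end RegretBound

/-! ### Continuity and measurability of MsMwC in the gains. -/

section Measurability

open Filter Topology

/-- The unique minimizer over a compact set depends continuously on the parameter. -/
theorem continuous_of_isMinOn_unique {G W : Type*} [TopologicalSpace G] [TopologicalSpace W]
    {K : Set W} (hK : IsCompact K) {Φ : G → W → ℝ} {f : G → W} (hf : ∀ x, f x ∈ K)
    (hmin : ∀ x, IsMinOn (Φ x) K (f x))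
    (huniq : ∀ x, ∀ y ∈ K, IsMinOn (Φ x) K y → y = f x)
    (hΦ : ∀ x, ∀ y ∈ K, ContinuousAt (Function.uncurry Φ) (x, y)) : Continuous f := by
  -- By compactness `f` converges along each ultrafilter. Its limit is again a minimizer at `x`,
  -- hence is `f x`.
  refine continuous_iff_continuousAt.2 fun x => tendsto_iff_ultrafilter _ _ _ |>.2 fun U hU => ?_
  obtain ⟨y, hyK, hy⟩ := hK.ultrafilter_le_nhds (U.map f)
    (le_principal_iff.2 (Ultrafilter.mem_map.2 (Filter.univ_mem' hf)))
  have hy' : Tendsto f U (𝓝 y) := hy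
  have hyx : y = f x := by
    refine huniq x y hyK (isMinOn_iff.2 fun w hw => ?_)
    have h1 : Tendsto (fun x' => Φ x' (f x')) U (𝓝 (Φ x y)) :=
      (hΦ x y hyK).tendsto.comp ((show Tendsto id U (𝓝 x) from hU).prodMk_nhds hy')
    have h2 : Tendsto (fun x' => Φ x' w) U (𝓝 (Φ x w)) :=
      (hΦ x w hw).tendsto.comp ((show Tendsto id U (𝓝 x) from hU).prodMk_nhds tendsto_const_nhds)
    exact le_of_tendsto_of_tendsto' h1 h2 fun x' => isMinOn_iff.1 (hmin x') w hw
  exact hyx ▸ hy'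

variable {κ : Type*} [Fintype κ]

theorem isCompact_truncatedSimplex (δ : ℝ) : IsCompact (truncatedSimplex κ δ) := by
  have hcl : IsClosed {w : κ → ℝ | ∀ k, δ ≤ w k} := by
    simp only [Set.ofPred_forall]
    exact isClosed_iInter fun k => isClosed_le continuous_const (continuous_apply k)
  exact (isCompact_stdSimplex ℝ κ).inter_right hcl

theorem continuous_learningRate (T t : ℕ) (k : κ) :
    Continuous fun g : ℕ → κ → ℝ => learningRate T g t k := by
  refine continuous_const.div ?_ fun g => (lt_of_lt_of_le (by norm_num) (inverseRate_ge T g t k)).ne'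
  fun_prop

theorem continuous_msMwC [Nonempty κ] {T : ℕ} (hT : 1 ≤ T) (t : ℕ) :
    Continuous fun g : ℕ → κ → ℝ => msMwC T g t := by
  induction t with
  | zero => exact continuous_const
  | succ t ih =>
    refine continuous_of_isMinOn_unique (isCompact_truncatedSimplex _)
      (Φ := fun g => stepObjective (learningRate T g t) (msMwC T g t) (g t))
      (fun g => msMwC_mem hT g (t + 1)) (fun g => (msMwC_succ_spec hT g t).2)
      (fun g w hw hmin => isMinOn_stepObjective_unique (truncation_pos hT)
        (learningRate_pos T g t) (msMwC_pos hT g t) (msMwC_succ_spec hT g t).1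
        (msMwC_succ_spec hT g t).2 hw hmin) fun g w hw => ?_
    have hw0 : ∀ k, 0 < w k := fun k => (truncation_pos hT).trans_le (hw.2 k)
    have hg : ∀ k, ContinuousAt (fun p : (ℕ → κ → ℝ) × (κ → ℝ) => p.1 t k) (g, w) :=
      fun k => by fun_prop
    have hwc : ∀ k, ContinuousAt (fun p : (ℕ → κ → ℝ) × (κ → ℝ) => p.2 k) (g, w) :=
      fun k => by fun_prop
    have hη : ∀ k, ContinuousAt
        (fun p : (ℕ → κ → ℝ) × (κ → ℝ) => learningRate T p.1 t k) (g, w) :=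
      fun k => ((continuous_learningRate T t k).comp continuous_fst).continuousAt
    have hq : ∀ k, ContinuousAt (fun p : (ℕ → κ → ℝ) × (κ → ℝ) => msMwC T p.1 t k) (g, w) :=
      fun k => (((continuous_apply k).comp ih).comp continuous_fst).continuousAt
    have hr : ∀ k, ContinuousAt (fun p : (ℕ → κ → ℝ) × (κ → ℝ) =>
        Real.log (p.2 k / msMwC T p.1 t k)) (g, w) := fun k =>
      ((hwc k).div (hq k) (msMwC_pos hT g t k).ne').log
        (div_pos (hw0 k) (msMwC_pos hT g t k)).ne'
    change ContinuousAt (fun p : (ℕ → κ → ℝ) × (κ → ℝ) =>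
      stepObjective (learningRate T p.1 t) (msMwC T p.1 t) (p.1 t) p.2) (g, w)
    unfold stepObjective weightedEntropyDiv
    refine ContinuousAt.add (tendsto_finsetSum _ fun k _ => ?_) (tendsto_finsetSum _ fun k _ => ?_)
    · exact (hwc k).mul ((hg k).neg.add ((continuousAt_const.mul (hη k)).mul ((hg k).pow 2)))
    · exact (continuousAt_const.div (hη k) (learningRate_pos T g t k).ne').mul
        ((((hwc k).mul (hr k)).sub (hwc k)).add (hq k))

theorem msMwC_congr {T : ℕ} {g g' : ℕ → κ → ℝ} {t : ℕ} (h : ∀ s < t, g s = g' s) :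
    msMwC T g t = msMwC T g' t := by
  induction t with
  | zero => rfl
  | succ t ih =>
    have h1 := ih fun s hs => h s (hs.trans (Nat.lt_succ_self t))
    have h2 : learningRate T g t = learningRate T g' t := by
      funext k
      unfold learningRate
      rw [Finset.sum_congr rfl fun s hs => by
        rw [h s ((Finset.mem_range.1 hs).trans (Nat.lt_succ_self t))]]
    simp only [msMwC]
    rw [h1, h2, h t (Nat.lt_succ_self t)]

theorem measurable_msMwC [Nonempty κ] {Ω : Type*} [MeasurableSpace Ω] {T : ℕ} (hT : 1 ≤ T) (t : ℕ)
    {g : Ω → ℕ → κ → ℝ} (hg : ∀ s < t, ∀ k, Measurable fun ω => g ω s k) (k : κ) :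
    Measurable fun ω => msMwC T (g ω) t k := by
  -- Gains from round `t` on do not affect the play and need not be measurable, so they are set to
  -- zero.
  have h1 : Measurable fun ω => (fun s k => if s < t then g ω s k else 0 : ℕ → κ → ℝ) := by
    refine measurable_pi_lambda _ fun s => measurable_pi_lambda _ fun k => ?_
    by_cases hs : s < t
    · simpa [hs] using hg s hs k
    · simp [hs]
  have h2 := (((continuous_apply k).comp (continuous_msMwC (κ := κ) hT t)).measurable).comp h1
  convert! h2 using 2 with ω
  exact congrFun (msMwC_congr fun s hs => by simp [hs]) k

end Measurability

/-! ### The minimax theorem for the round game. -/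

section Minimax

/-- If against every outcome some prediction in `N` has payoff at most `ε`, then some distribution
on `N` has expected payoff at most `ε` against all outcomes. -/
theorem exists_isDistributionOn_forall_le {d : ℕ} {C : Set (Fin d → ℝ)} (hCv : Convex ℝ C)
    (hCc : IsCompact C) [Nonempty C] (N : Finset C) (hN : N.Nonempty) (a : C → ℝ)
    (l : C → (Fin d → ℝ) →ₗ[ℝ] ℝ) {ε : ℝ}
    (h : ∀ y : C, ∃ c ∈ N, a c + l c y ≤ ε) :
    ∃ ψ, IsDistributionOn N ψ ∧ ∀ y : C, ∑ c ∈ N, ψ c * (a c + l c y) ≤ ε := by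
  classical
  have : Nonempty N := hN.to_subtype
  have hlc : ∀ c, Continuous (l c) := fun c => (l c).continuous_of_finiteDimensional
  obtain ⟨x, hx, b, hb, hsad⟩ := Sion.exists_isSaddlePointOn (X := stdSimplex ℝ N) (Y := C)
    (f := fun x y => ∑ c : N, x c * (a c + l c y))
    ⟨_, single_mem_stdSimplex ℝ (Classical.arbitrary N)⟩ (convex_stdSimplex ℝ N)
    (isCompact_stdSimplex ℝ N)
    (fun y _ => Continuous.lowerSemicontinuous (by fun_prop) |>.lowerSemicontinuousOn _)
    (fun y _ => by
      have : ConvexOn ℝ (stdSimplex ℝ N) fun x : N → ℝ => ∑ c : N, x c * (a c + l c y) := by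
        refine ⟨convex_stdSimplex ℝ N, fun x _ y _ s t _ _ _ => le_of_eq ?_⟩
        simp only [Pi.add_apply, Pi.smul_apply, smul_eq_mul, Finset.mul_sum,
          ← Finset.sum_add_distrib]
        exact Finset.sum_congr rfl fun c _ => by ring
      exact this.quasiconvexOn)
    hCv Set.Nonempty.of_subtype hCc
    (fun x _ => by
      have : Continuous fun y => ∑ c : N, x c * (a c + l c y) :=
        continuous_finsetSum _ fun c _ => continuous_const.mul (continuous_const.add (hlc c))
      exact this.upperSemicontinuous.upperSemicontinuousOn _)
    (fun x _ => by
      have : ConcaveOn ℝ C fun y => ∑ c : N, x c * (a c + l c y) := by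
        refine ⟨hCv, fun y _ y' _ s t _ _ hst => le_of_eq ?_⟩
        simp only [map_add, map_smul, smul_eq_mul, Finset.mul_sum, ← Finset.sum_add_distrib]
        refine Finset.sum_congr rfl fun c _ => ?_
        have : a c = (s + t) * a c := by rw [hst, one_mul]
        rw [this]
        ring_nf
        rw [show s = 1 - t by linarith]
        ring
      exact this.quasiconcaveOn)
  -- At the saddle point `(x, b)`, the value of `x` against any `y` is at most that of the pure
  -- reply to `b`.
  obtain ⟨c, hcN, hc⟩ := h ⟨b, hb⟩
  refine ⟨fun c => if hc : c ∈ N then x ⟨c, hc⟩ else 0, ⟨fun c hc => ?_, ?_⟩, fun y => ?_⟩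
  · simpa [hc] using hx.1 ⟨c, hc⟩
  · rw [← Finset.sum_coe_sort]
    simpa using hx.2
  · have h1 := hsad _ (single_mem_stdSimplex ℝ (⟨c, hcN⟩ : N)) y y.2
    rw [← Finset.sum_coe_sort]
    simp [Pi.single_apply] at h1 ⊢
    linarith

end Minimax

/-! ### Payoff and bias in terms of the experts. -/

section Rounds

variable {d : ℕ} {X : Type*} {C : Set (Fin d → ℝ)}

theorem eventAt_nonneg (E : Event X C) (z : ℕ → X × C × C) (t : ℕ) (c : C) : 0 ≤ eventAt E z t c :=
  (E (transcript z t) (z t).1 c).2.1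

theorem eventAt_le_one (E : Event X C) (z : ℕ → X × C × C) (t : ℕ) (c : C) : eventAt E z t c ≤ 1 :=
  (E (transcript z t) (z t).1 c).2.2

theorem abs_expertGain_le {𝓔 : Finset (Event X C)} (z : ℕ → X × C × C) (t : ℕ)
    (k : EventExpert 𝓔) (c y : C) :
    |expertGain z t k c y| ≤ eventAt k.2.2.1 z t c * |c.1 k.1 - y.1 k.1| := by
  have h : |((k.2.1 : ℤ) : ℝ)| = 1 := by
    rcases Int.units_eq_one_or k.2.1 with h | h <;> simp [h]
  rw [expertGain, abs_mul, abs_mul, h, one_mul, abs_of_nonneg (eventAt_nonneg _ _ _ _)]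

theorem abs_expertGain_le_norm {𝓔 : Finset (Event X C)} (z : ℕ → X × C × C) (t : ℕ)
    (k : EventExpert 𝓔) (c y : C) : |expertGain z t k c y| ≤ ‖c.1 - y.1‖ := by
  refine (abs_expertGain_le z t k c y).trans
    ((mul_le_of_le_one_left (abs_nonneg _) (eventAt_le_one _ _ _ _)).trans ?_)
  exact norm_le_pi_norm (c.1 - y.1) k.1

theorem norm_sub_le_one (hC : ∀ y ∈ C, 2 * ‖y‖ ≤ 1) (c y : C) : ‖c.1 - y.1‖ ≤ 1 := by
  linarith [norm_sub_le c.1 y.1, hC c c.2, hC y y.2]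

theorem abs_roundPayoff_le {T : ℕ} (hT : 1 ≤ T) {𝓔 : Finset (Event X C)} [Nonempty (EventExpert 𝓔)]
    (z : ℕ → X × C × C) (t : ℕ) (c y : C) : |roundPayoff T 𝓔 z t c y| ≤ ‖c.1 - y.1‖ := by
  have hq := msMwC_mem hT (realizedGain 𝓔 z) t
  refine (Finset.abs_sum_le_sum_abs _ _).trans ?_
  rw [← one_mul ‖c.1 - y.1‖, ← hq.1.2, Finset.sum_mul]
  refine Finset.sum_le_sum fun k _ => ?_
  rw [abs_mul, abs_of_nonneg (hq.1.1 k)]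
  exact mul_le_mul_of_nonneg_left (abs_expertGain_le_norm z t k c y) (hq.1.1 k)

theorem roundPayoff_eq_affine (T : ℕ) (𝓔 : Finset (Event X C)) (z : ℕ → X × C × C) (t : ℕ) :
    ∃ (a : C → ℝ) (l : C → (Fin d → ℝ) →ₗ[ℝ] ℝ),
      ∀ c y : C, roundPayoff T 𝓔 z t c y = a c + l c y := by
  refine ⟨fun c => ∑ k : EventExpert 𝓔, msMwC T (realizedGain 𝓔 z) t k *
      (((k.2.1 : ℤ) : ℝ) * eventAt k.2.2.1 z t c * c.1 k.1),
    fun c => ∑ k : EventExpert 𝓔, (-(msMwC T (realizedGain 𝓔 z) t k *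
      (((k.2.1 : ℤ) : ℝ) * eventAt k.2.2.1 z t c))) • LinearMap.proj k.1, fun c y => ?_⟩
  simp only [roundPayoff, expertGain, LinearMap.sum_apply, LinearMap.smul_apply,
    LinearMap.proj_apply, smul_eq_mul, ← Finset.sum_add_distrib]
  exact Finset.sum_congr rfl fun k _ => by ring

/-- An approximate minimax strategy on a net has small expected payoff against every outcome. -/
theorem sum_mul_roundPayoff_le (hCv : Convex ℝ C) (hCc : IsCompact C)
    (hC : ∀ y ∈ C, 2 * ‖y‖ ≤ 1) {T : ℕ} (hT : 1 ≤ T) {𝓔 : Finset (Event X C)}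
    [Nonempty (EventExpert 𝓔)] {z : ℕ → X × C × C} {t : ℕ} {N : Finset C} {ε : ℝ}
    (hN : IsSupNet ε N) {ψ : C → ℝ} (hψ : IsApproxMinimax N (roundPayoff T 𝓔 z t) ε ψ) (y : C) :
    ∑ c ∈ N, ψ c * roundPayoff T 𝓔 z t c y ≤ 2 * ε := by
  have : Nonempty C := ⟨y⟩
  obtain ⟨a, l, hal⟩ := roundPayoff_eq_affine T 𝓔 z t
  obtain ⟨c₀, hc₀, -⟩ := hN y
  obtain ⟨ψ', hψ', hle⟩ := exists_isDistributionOn_forall_le hCv hCc N ⟨c₀, hc₀⟩ a l (ε := ε)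
    fun y => by
      obtain ⟨c, hc, hcy⟩ := hN y
      refine ⟨c, hc, ?_⟩
      rw [← hal]
      exact (le_abs_self _).trans ((abs_roundPayoff_le hT z t c y).trans hcy)
  have h1 : worstCase N (roundPayoff T 𝓔 z t) ψ' ≤ ε :=
    ciSup_le fun y => by simpa only [hal] using hle y
  -- An unbounded real supremum would be `0` and bound nothing.
  have hbdd : BddAbove (Set.range fun y : C => ∑ c ∈ N, ψ c * roundPayoff T 𝓔 z t c y) := by
    refine ⟨1, ?_⟩
    rintro _ ⟨y, rfl⟩
    rw [← hψ.1.2]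
    exact Finset.sum_le_sum fun c hc => mul_le_of_le_one_right (hψ.1.1 c hc)
      ((le_abs_self _).trans ((abs_roundPayoff_le hT z t c y).trans (norm_sub_le_one hC c y)))
  have h2 : ∑ c ∈ N, ψ c * roundPayoff T 𝓔 z t c y ≤ worstCase N (roundPayoff T 𝓔 z t) ψ :=
    le_ciSup hbdd y
  linarith [hψ.2 ψ' hψ']

/-- The pathwise bound on the bias of the predictions on an event. -/
theorem abs_sum_eventAt_le (hC : ∀ y ∈ C, 2 * ‖y‖ ≤ 1) {T : ℕ} (hT : 1 ≤ T)
    {𝓔 : Finset (Event X C)} (z : ℕ → X × C × C) (i : Fin d) {E : Event X C} (hE : E ∈ 𝓔) :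
    |∑ t ∈ Finset.range T, eventAt E z t (z t).2.1 * ((z t).2.1.1 i - (z t).2.2.1 i)| ≤
      ∑ t ∈ Finset.range T, roundPayoff T 𝓔 z t (z t).2.1 (z t).2.2 +
      (70 * Real.log (Fintype.card (EventExpert 𝓔) * T) +
        129 * √(Real.log (Fintype.card (EventExpert 𝓔) * T) *
          ∑ t ∈ Finset.range T, eventAt E z t (z t).2.1 ^ 2)) := by
  classical
  have : Nonempty (EventExpert 𝓔) := ⟨(i, 1, ⟨E, hE⟩)⟩
  have hκ : 2 ≤ Fintype.card (EventExpert 𝓔) := by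
    have : Nontrivial (EventExpert 𝓔) := ⟨(i, 1, ⟨E, hE⟩), (i, -1, ⟨E, hE⟩), by simp [Prod.ext_iff]⟩
    exact Fintype.one_lt_card
  have hL := half_le_log_card_mul hκ hT
  have hg : ∀ t k, |realizedGain 𝓔 z t k| ≤ 1 := fun t k =>
    (abs_expertGain_le_norm z t k _ _).trans (norm_sub_le_one hC _ _)
  have hsq : ∀ σ : ℤˣ, √(Real.log (Fintype.card (EventExpert 𝓔) * T) *
      ∑ t ∈ Finset.range T, realizedGain 𝓔 z t (i, σ, ⟨E, hE⟩) ^ 2) ≤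
      √(Real.log (Fintype.card (EventExpert 𝓔) * T) *
          ∑ t ∈ Finset.range T, eventAt E z t (z t).2.1 ^ 2) := fun σ => by
    refine Real.sqrt_le_sqrt (mul_le_mul_of_nonneg_left (Finset.sum_le_sum fun t _ => ?_)
      (by linarith))
    rw [← sq_abs]
    refine pow_le_pow_left₀ (abs_nonneg _) ((abs_expertGain_le z t _ _ _).trans
      (mul_le_of_le_one_right (eventAt_nonneg _ _ _ _) ?_)) 2
    exact (norm_le_pi_norm ((z t).2.1.1 - (z t).2.2.1) i).trans (norm_sub_le_one hC _ _)
  have h1 := msMwC_regret hκ hT hg (i, 1, ⟨E, hE⟩)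
  have h2 := msMwC_regret hκ hT hg (i, -1, ⟨E, hE⟩)
  have e1 : ∑ t ∈ Finset.range T, realizedGain 𝓔 z t (i, 1, ⟨E, hE⟩) =
      ∑ t ∈ Finset.range T, eventAt E z t (z t).2.1 * ((z t).2.1.1 i - (z t).2.2.1 i) := by
    simp [realizedGain, expertGain]
  have e2 : ∑ t ∈ Finset.range T, realizedGain 𝓔 z t (i, -1, ⟨E, hE⟩) =
      -∑ t ∈ Finset.range T, eventAt E z t (z t).2.1 * ((z t).2.1.1 i - (z t).2.2.1 i) := by
    simp [realizedGain, expertGain]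
  have e3 : ∑ t ∈ Finset.range T, ∑ j, msMwC T (realizedGain 𝓔 z) t j * realizedGain 𝓔 z t j =
      ∑ t ∈ Finset.range T, roundPayoff T 𝓔 z t (z t).2.1 (z t).2.2 := rfl
  rw [e1, e3] at h1
  rw [e2, e3] at h2
  refine abs_le'.2 ⟨?_, ?_⟩ <;> linarith [hsq 1, hsq (-1)]

end Rounds

/-! ### Expectations over the sampled prediction. -/

section Sampling

variable {Ω α : Type*}

/-- Reduces everything evaluated at the random prediction to finitely many fixed predictions. -/
theorem comp_eq_sum_indicator [DecidableEq α] {N : Finset α} {p : Ω → α} (hpN : ∀ ω, p ω ∈ N)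
    (f : α → Ω → ℝ) (ω : Ω) :
    f (p ω) ω = ∑ c ∈ N, f c ω * {ω | p ω = c}.indicator (fun _ => (1 : ℝ)) ω := by
  rw [Finset.sum_eq_single_of_mem (p ω) (hpN ω) fun c _ hc => by simp [hc.symm]]
  simp

variable [MeasurableSpace α] [MeasurableSingletonClass α]

theorem measurable_comp_of_finite {m : MeasurableSpace Ω} {N : Finset α} {p : Ω → α}
    (hp : Measurable p) (hpN : ∀ ω, p ω ∈ N) {f : α → Ω → ℝ} (hf : ∀ c ∈ N, Measurable (f c)) :
    Measurable fun ω => f (p ω) ω := by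
  classical
  simp_rw [comp_eq_sum_indicator hpN f]
  exact Finset.measurable_sum _ fun c hc => (hf c hc).mul
    (measurable_const.indicator (hp (measurableSet_singleton c)))

/-- If `p` is drawn from the conditional distribution `ψ` given `m'`, then a bound on the
`ψ`-average of an `m'`-measurable family bounds the expectation of the family at `p`. -/
theorem integral_comp_le_of_condExp {m' m : MeasurableSpace Ω} (hm : m' ≤ m) {μ : Measure Ω}
    [IsProbabilityMeasure μ] {N : Finset α} {p : Ω → α} (hp : Measurable p)
    (hpN : ∀ ω, p ω ∈ N) {ψ : Ω → α → ℝ}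
    (hψ : ∀ c ∈ N, μ[{ω | p ω = c}.indicator fun _ => (1 : ℝ) | m'] =ᵐ[μ] fun ω => ψ ω c)
    {f : α → Ω → ℝ} (hf : ∀ c ∈ N, Measurable[m'] (f c)) (hfb : ∀ c ω, |f c ω| ≤ 1) {B : ℝ}
    (hB : ∀ ω, ∑ c ∈ N, ψ ω c * f c ω ≤ B) : ∫ ω, f (p ω) ω ∂μ ≤ B := by
  classical
  have hind : ∀ c, Integrable ({ω | p ω = c}.indicator fun _ => (1 : ℝ)) μ := fun c =>
    (integrable_const 1).indicator (hp (measurableSet_singleton c))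
  have hint : ∀ c ∈ N, Integrable (f c * {ω | p ω = c}.indicator fun _ => (1 : ℝ)) μ :=
    fun c hc => (hind c).bdd_mul ((hf c hc).mono hm le_rfl).aestronglyMeasurable
      (Filter.Eventually.of_forall fun ω => hfb c ω)
  have hce : ∀ c ∈ N, μ[f c * {ω | p ω = c}.indicator fun _ => (1 : ℝ) | m'] =ᵐ[μ]
      fun ω => ψ ω c * f c ω := fun c hc => by
    refine (condExp_mul_of_stronglyMeasurable_left (hf c hc).stronglyMeasurable (hint c hc)
      (hind c)).trans ?_
    filter_upwards [hψ c hc] with ω h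
    rw [Pi.mul_apply, h, mul_comm]
  -- Integrability comes from the conditional expectation, as `ψ` itself is not assumed measurable.
  have hint' : ∀ c ∈ N, Integrable (fun ω => ψ ω c * f c ω) μ := fun c hc =>
    integrable_condExp.congr (hce c hc)
  calc ∫ ω, f (p ω) ω ∂μ
      = ∫ ω, ∑ c ∈ N, f c ω * {ω | p ω = c}.indicator (fun _ => (1 : ℝ)) ω ∂μ :=
        integral_congr_ae (Filter.Eventually.of_forall (comp_eq_sum_indicator hpN f))
    _ = ∑ c ∈ N, ∫ ω, f c ω * {ω | p ω = c}.indicator (fun _ => (1 : ℝ)) ω ∂μ :=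
        integral_finsetSum _ hint
    _ = ∑ c ∈ N, ∫ ω, ψ ω c * f c ω ∂μ := Finset.sum_congr rfl fun c hc => by
        rw [← integral_congr_ae (hce c hc), integral_condExp hm]
        rfl
    _ = ∫ ω, ∑ c ∈ N, ψ ω c * f c ω ∂μ := (integral_finsetSum _ hint').symm
    _ ≤ ∫ _, B ∂μ := integral_mono (integrable_finsetSum _ hint') (integrable_const B) hB
    _ = B := by simp

theorem integral_sqrt_le_sqrt_integral {m : MeasurableSpace Ω} {μ : Measure Ω}
    [IsProbabilityMeasure μ] {f : Ω → ℝ} (hf0 : ∀ ω, 0 ≤ f ω) (hf : Integrable f μ)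
    (hs : Integrable (fun ω => √(f ω)) μ) : ∫ ω, √(f ω) ∂μ ≤ √(∫ ω, f ω ∂μ) :=
  Real.strictConcaveOn_sqrt.concaveOn.le_map_integral Real.continuous_sqrt.continuousOn
    isClosed_Ici (Filter.Eventually.of_forall hf0) hf hs

theorem sum_two_div_le (T : ℕ) :
    ∑ t ∈ Finset.range T, 2 * (1 / ((t : ℝ) + 1)) ≤ 2 * (1 + Real.log T) := by
  have h := harmonic_le_one_add_log T
  rw [harmonic] at h
  push_cast at h
  rw [← Finset.mul_sum]
  simpa only [one_div] using mul_le_mul_of_nonneg_left h zero_le_two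

end Sampling

/-! ### Measurable payoffs and the final bound. -/

theorem measurable_expertGain {Ω : Type*} {m : MeasurableSpace Ω} {d : ℕ} {X : Type*}
    {C : Set (Fin d → ℝ)} {𝓔 : Finset (Event X C)} {z : ℕ → Ω → X × C × C} {t : ℕ}
    {k : EventExpert 𝓔} {c : C}
    (hE : Measurable fun ω => eventAt k.2.2.1 (fun s => z s ω) t c)
    (hy : Measurable fun ω => (z t ω).2.2) :
    Measurable fun ω => expertGain (fun s => z s ω) t k c (z t ω).2.2 :=
  (hE.const_mul _).mul (measurable_const.sub
    (((measurable_pi_apply k.1).comp measurable_subtype_coe).comp hy))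

theorem measurable_roundPayoff {Ω : Type*} {m : MeasurableSpace Ω} {d : ℕ} {X : Type*}
    {C : Set (Fin d → ℝ)} {𝓔 : Finset (Event X C)} [Nonempty (EventExpert 𝓔)]
    {z : ℕ → Ω → X × C × C} {T t : ℕ} (hT : 1 ≤ T) {c : C}
    (hreal : ∀ s < t, ∀ k : EventExpert 𝓔,
      Measurable fun ω => realizedGain 𝓔 (fun s => z s ω) s k)
    (hgain : ∀ k : EventExpert 𝓔,
      Measurable fun ω => expertGain (fun s => z s ω) t k c (z t ω).2.2) :
    Measurable fun ω => roundPayoff T 𝓔 (fun s => z s ω) t c (z t ω).2.2 :=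
  Finset.measurable_sum _ fun k _ => (measurable_msMwC hT t hreal k).mul (hgain k)

/-- Rounds are numbered `0, …, T - 1`.  In round `t` the context is `(z t ω).1`, the prediction
`(z t ω).2.1` and the outcome `(z t ω).2.2`; the σ-algebra `F t` holds what has happened before the
prediction of round `t` is drawn, the outcome of round `t` (which may depend on the past
arbitrarily) included. -/
theorem mainTheorem2 :
    ∃ K : ℝ, 0 < K ∧
      ∀ (d : ℕ) (C : Set (Fin d → ℝ)), Convex ℝ C → IsCompact C → (∀ y ∈ C, 2 * ‖y‖ ≤ 1) →
      ∀ (X : Type*) (𝓔 : Finset (Event X C)) (T : ℕ), 1 ≤ T →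
      ∀ N : ℕ → Finset C, (∀ t < T, IsSupNet (1 / ((t : ℝ) + 1)) (N t)) →
      ∀ (Ω : Type*) (m : MeasurableSpace Ω) (μ : Measure Ω), IsProbabilityMeasure μ →
      ∀ (F : Filtration ℕ m) (z : ℕ → Ω → X × C × C) (ψ : ℕ → Ω → C → ℝ),
        -- the adversary chooses outcome and context before the prediction is drawn
        (∀ t < T, Measurable[F t] fun ω => (z t ω).2.2) →
        (∀ t < T, ∀ E ∈ 𝓔, ∀ c ∈ N t, Measurable[F t] fun ω => eventAt E (fun s => z s ω) t c) →
        -- the prediction lies in the net and is drawn from `ψ t`, given all that happened before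
        (∀ t < T, Measurable[F (t + 1)] fun ω => (z t ω).2.1) →
        (∀ t < T, ∀ ω, (z t ω).2.1 ∈ N t) →
        (∀ t < T, ∀ c ∈ N t,
          μ[{ω | (z t ω).2.1 = c}.indicator fun _ => (1 : ℝ) | F t] =ᵐ[μ] fun ω => ψ t ω c) →
        -- `ψ t` is an approximate minimax strategy for the game of round `t`
        (∀ t < T, ∀ ω, IsApproxMinimax (N t) (roundPayoff T 𝓔 (fun s => z s ω) t)
          (1 / ((t : ℝ) + 1)) (ψ t ω)) →
        ∀ (i : Fin d), ∀ E ∈ 𝓔,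
          Integrable (fun ω => |∑ t ∈ Finset.range T, eventAt E (fun s => z s ω) t (z t ω).2.1 *
            ((z t ω).2.1.1 i - (z t ω).2.2.1 i)|) μ ∧
          ∫ ω, |∑ t ∈ Finset.range T, eventAt E (fun s => z s ω) t (z t ω).2.1 *
              ((z t ω).2.1.1 i - (z t ω).2.2.1 i)| ∂μ ≤
            K * (Real.log (2 * d * 𝓔.card * T) +
              √(Real.log (2 * d * 𝓔.card * T) *
                ∑ t ∈ Finset.range T, ∫ ω, eventAt E (fun s => z s ω) t (z t ω).2.1 ^ 2 ∂μ)) := by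
  refine ⟨129, by norm_num, fun d C hCv hCc hC X 𝓔 T hT N hN Ω m μ _ F z ψ hy hEv hp hpN
    hψ hmm i E hE => ?_⟩
  have hEp : ∀ t < T, ∀ E ∈ 𝓔, Measurable fun ω => eventAt E (fun s => z s ω) t (z t ω).2.1 :=
    fun t ht E hE => measurable_comp_of_finite ((hp t ht).mono (F.le _) le_rfl) (hpN t ht)
      fun c hc => (hEv t ht E hE c hc).mono (F.le _) le_rfl
  have : Nonempty (EventExpert 𝓔) := ⟨(i, 1, ⟨E, hE⟩)⟩
  have hgain : ∀ t < T, ∀ k : EventExpert 𝓔, ∀ c ∈ N t,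
      Measurable[F t] fun ω => expertGain (fun s => z s ω) t k c (z t ω).2.2 :=
    fun t ht k c hc => measurable_expertGain (hEv t ht _ k.2.2.2 c hc) (hy t ht)
  -- The prediction of round `s` is known only in `F (s + 1)`, which lies in `F t` as `s < t`.
  have hreal : ∀ t ≤ T, ∀ s < t, ∀ k : EventExpert 𝓔,
      Measurable[F t] fun ω => realizedGain 𝓔 (fun s => z s ω) s k := fun t ht s hs k =>
    (measurable_comp_of_finite (hp s (hs.trans_le ht)) (hpN s (hs.trans_le ht)) fun c hc =>
      (hgain s (hs.trans_le ht) k c hc).mono (F.mono (Nat.le_succ s)) le_rfl).mono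
        (F.mono (Nat.succ_le_of_lt hs)) le_rfl
  have hpay : ∀ t < T, ∀ c ∈ N t,
      Measurable[F t] fun ω => roundPayoff T 𝓔 (fun s => z s ω) t c (z t ω).2.2 :=
    fun t ht c hc => measurable_roundPayoff hT (hreal t ht.le) fun k => hgain t ht k c hc
  have hpayb : ∀ t ω, ∀ c : C, |roundPayoff T 𝓔 (fun s => z s ω) t c (z t ω).2.2| ≤ 1 :=
    fun t ω c => (abs_roundPayoff_le hT _ t c _).trans (norm_sub_le_one hC _ _)
  have hpayp : ∀ t < T, Integrable
      (fun ω => roundPayoff T 𝓔 (fun s => z s ω) t (z t ω).2.1 (z t ω).2.2) μ := fun t ht =>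
    Integrable.of_bound (measurable_comp_of_finite ((hp t ht).mono (F.le _) le_rfl) (hpN t ht)
      fun c hc => (hpay t ht c hc).mono (F.le _) le_rfl).aestronglyMeasurable 1
      (Filter.Eventually.of_forall fun ω => hpayb t ω _)
  have hpayle : ∀ t < T, ∫ ω, roundPayoff T 𝓔 (fun s => z s ω) t (z t ω).2.1 (z t ω).2.2 ∂μ ≤
      2 * (1 / ((t : ℝ) + 1)) := fun t ht =>
    integral_comp_le_of_condExp (F.le t) ((hp t ht).mono (F.le _) le_rfl) (hpN t ht) (hψ t ht)
      (f := fun c ω => roundPayoff T 𝓔 (fun s => z s ω) t c (z t ω).2.2) (hpay t ht)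
      (fun c ω => hpayb t ω c)
      fun ω => sum_mul_roundPayoff_le hCv hCc hC hT (hN t ht) (hmm t ht ω) _
  have hcoord : ∀ j, Measurable fun c : C => c.1 j := fun j =>
    (measurable_pi_apply j).comp measurable_subtype_coe
  have hS : Measurable fun ω => ∑ t ∈ Finset.range T, eventAt E (fun s => z s ω) t (z t ω).2.1 *
      ((z t ω).2.1.1 i - (z t ω).2.2.1 i) := Finset.measurable_sum _ fun t ht => by
    have ht := Finset.mem_range.1 ht
    exact (hEp t ht E hE).mul (((hcoord i).comp ((hp t ht).mono (F.le _) le_rfl)).sub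
      ((hcoord i).comp ((hy t ht).mono (F.le _) le_rfl)))
  have hSb : ∀ ω, |∑ t ∈ Finset.range T, eventAt E (fun s => z s ω) t (z t ω).2.1 *
      ((z t ω).2.1.1 i - (z t ω).2.2.1 i)| ≤ T := fun ω => by
    refine (Finset.abs_sum_le_sum_abs _ _).trans ((Finset.sum_le_sum fun t _ => ?_).trans_eq
      (by simp : ∑ _t ∈ Finset.range T, (1 : ℝ) = T))
    rw [abs_mul, abs_of_nonneg (eventAt_nonneg _ _ _ _)]
    exact mul_le_one₀ (eventAt_le_one _ _ _ _) (abs_nonneg _)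
      ((norm_le_pi_norm ((z t ω).2.1.1 - (z t ω).2.2.1) i).trans (norm_sub_le_one hC _ _))
  have hSint : Integrable (fun ω => |∑ t ∈ Finset.range T,
      eventAt E (fun s => z s ω) t (z t ω).2.1 * ((z t ω).2.1.1 i - (z t ω).2.2.1 i)|) μ :=
    (Integrable.of_bound hS.aestronglyMeasurable T (Filter.Eventually.of_forall hSb)).abs
  refine ⟨hSint, ?_⟩
  have hcard : ((Fintype.card (EventExpert 𝓔) : ℝ) * T) = 2 * d * 𝓔.card * T := by
    rw [Fintype.card_prod, Fintype.card_prod, Fintype.card_fin, Fintype.card_units_int,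
      Fintype.card_coe]
    push_cast
    ring
  have hd : (1 : ℝ) ≤ d := by exact_mod_cast (Nat.zero_le _).trans_lt i.2
  have hEc : (1 : ℝ) ≤ 𝓔.card := by exact_mod_cast Finset.card_pos.2 ⟨E, hE⟩
  have hT1 : (1 : ℝ) ≤ T := by exact_mod_cast hT
  have h2T : 2 * (T : ℝ) ≤ 2 * d * 𝓔.card * T := by
    refine mul_le_mul_of_nonneg_right ?_ (by linarith)
    nlinarith
  have hLT : Real.log 2 + Real.log T ≤ Real.log (2 * d * 𝓔.card * T) := by
    rw [← Real.log_mul two_ne_zero (by linarith)]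
    exact Real.log_le_log (by linarith) h2T
  have hlogT := Real.log_nonneg hT1
  have hlog2 := Real.log_two_gt_d9
  have hpath := fun ω => abs_sum_eventAt_le hC hT (fun s => z s ω) i hE
  simp only [hcard] at hpath
  set L := Real.log (2 * d * 𝓔.card * T)
  have hEsq : ∀ t ∈ Finset.range T,
      Integrable (fun ω => eventAt E (fun s => z s ω) t (z t ω).2.1 ^ 2) μ := fun t ht =>
    Integrable.of_bound ((hEp t (Finset.mem_range.1 ht) E hE).pow_const 2).aestronglyMeasurable 1
      (Filter.Eventually.of_forall fun ω => by
        rw [Real.norm_of_nonneg (sq_nonneg _)]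
        exact pow_le_one₀ (eventAt_nonneg _ _ _ _) (eventAt_le_one _ _ _ _))
  have hVint : Integrable (fun ω => L * ∑ t ∈ Finset.range T,
      eventAt E (fun s => z s ω) t (z t ω).2.1 ^ 2) μ := (integrable_finsetSum _ hEsq).const_mul L
  have hV0 : ∀ ω, 0 ≤ L * ∑ t ∈ Finset.range T,
      eventAt E (fun s => z s ω) t (z t ω).2.1 ^ 2 := fun ω =>
    mul_nonneg (by linarith) (Finset.sum_nonneg fun t _ => sq_nonneg _)
  -- Dominated through `√v ≤ v + 1`.
  have hsqrt : Integrable (fun ω => √(L * ∑ t ∈ Finset.range T,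
      eventAt E (fun s => z s ω) t (z t ω).2.1 ^ 2)) μ :=
    (hVint.add (integrable_const 1)).mono' hVint.1.aemeasurable.sqrt.aestronglyMeasurable
      (Filter.Eventually.of_forall fun ω => by
        rw [Real.norm_of_nonneg (Real.sqrt_nonneg _)]
        refine Real.sqrt_le_iff.2 ⟨by simp only [Pi.add_apply]; linarith [hV0 ω], ?_⟩
        simp only [Pi.add_apply]
        nlinarith [hV0 ω])
  have hpaysum := integrable_finsetSum (Finset.range T)
    fun t ht => hpayp t (Finset.mem_range.1 ht)
  have hrhs : Integrable (fun ω => 70 * L + 129 * √(L * ∑ t ∈ Finset.range T,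
      eventAt E (fun s => z s ω) t (z t ω).2.1 ^ 2)) μ :=
    (integrable_const _).add (hsqrt.const_mul 129)
  have h1 := integral_mono hSint (hpaysum.add hrhs) hpath
  simp only [Pi.add_apply] at h1
  rw [integral_add hpaysum hrhs, integral_add (integrable_const _) (hsqrt.const_mul 129),
    integral_finsetSum _ fun t ht => hpayp t (Finset.mem_range.1 ht), integral_const,
    integral_const_mul, probReal_univ, one_smul] at h1
  have h2 := integral_sqrt_le_sqrt_integral hV0 hVint hsqrt
  rw [integral_const_mul, integral_finsetSum _ hEsq] at h2
  have h3 := (Finset.sum_le_sum fun t ht => hpayle t (Finset.mem_range.1 ht)).trans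
    (sum_two_div_le T)
  -- The payoffs add `2 * (1 + log T)`, which fits into the slack `(129 - 70) * L` since `L ≥ log 2
  -- + log T`.
  linarith
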